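/- Let $\mathbb K\in\{\mathbb R,\mathbb C\}$ and let $A$ be a $\mathbb K$-algebra with unit that is complete with respect to a submultiplicative norm $\|\cdot\|$ (the norm of the unit need not be $1$); for example, $A=\mathbb K^{n\times n}$ with any submultiplicative matrix norm. For a word $w$ in two noncommuting letters $x,y$ let $g_w\in\mathbb Q$ be the Goldberg coefficient, i.e. the coefficient of $w$ in the formal solution $\log(e^{x}e^{y})=\sum_{n\ge 1}\frac{(-1)^{n-1}}{n}(e^{x}e^{y}-1)^n$ of $e^{x}e^{y}=e^{z}$, and for $X,Y\in A$ put $z_k(X,Y)=\sum_{|w|=k} g_w\, w(X,Y)$, where the sum is over all words of length $k$ and $w(X,Y)\in A$ is the product obtained from $w$ by substituting $X$ for $x$ and $Y$ for $y$. Let $0<\mu<1$ and let $X,Y\in A$ with $\|X\|,\|Y\|\le\mu$. Then $\|z_k(X,Y)\|\le\mu^k$ for all $k\ge 2$. Consequently the Goldberg series $$Z = X+Y+\sum_{k=2}^\infty z_k(X,Y)$$ converges absolutely; moreover its sum satisfies $\exp(X)\exp(Y)=\exp(Z)$, and $$\|Z\| < \|X\|+\|Y\|+\sum_{k=2}^\infty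 \mu^k .$$ -/

import Mathlib

/-- A formal power series with rational coefficients in two noncommuting variables, given by its
coefficients. Words are lists over the alphabet `Fin 2`, where `0` is the letter `X` and `1` is the
letter `Y`. -/
abbrev NCSeries : Type := List (Fin 2) → ℚ

namespace NCSeries

/-- The series `1`. -/
def one : NCSeries := fun w => if w = [] then 1 else 0

/-- The series consisting of the single letter `a`. -/
def letter (a : Fin 2) : NCSeries := fun w => if w = [a] then 1 else 0

/-- The product induced by concatenation of words: sum over all factorizations `w = u v`. -/
def mul (f g : NCSeries) : NCSeries := fun w =>
  ∑ i ∈ Finset.range (w.length + 1), f (w.take i) * g (w.drop i)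

/-- Powers of a series. -/
def pow (f : NCSeries) : ℕ → NCSeries
  | 0 => one
  | n + 1 => mul f (pow f n)

/-- The formal exponential `∑ₙ fⁿ / n!` of a series `f` without constant term. As `fⁿ` has no words
of length `< n`, only `n ≤ |w|` contributes to the coefficient of `w`. -/
def exp (f : NCSeries) : NCSeries := fun w =>
  ∑ n ∈ Finset.range (w.length + 1), (1 / (n.factorial : ℚ)) * pow f n w

/-- The formal logarithm `∑_{n ≥ 1} (-1)ⁿ⁻¹ (f - 1)ⁿ / n` of a series `f` with constant term `1`.
As `(f - 1)ⁿ` has no words of length `< n`, only `n ≤ |w|` contributes to the coefficient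
of `w`. -/
def log (f : NCSeries) : NCSeries := fun w =>
  ∑ n ∈ Finset.Icc 1 w.length, ((-1 : ℚ) ^ (n - 1) / (n : ℚ)) * pow (f - one) n w

end NCSeries

/-- The Goldberg coefficient `g_w`: the coefficient of the word `w` in the formal solution
`Z = log (exp X exp Y)` of `exp X exp Y = exp Z`. -/
def goldbergCoeff : List (Fin 2) → ℚ :=
  NCSeries.log
    (NCSeries.mul (NCSeries.exp (NCSeries.letter 0)) (NCSeries.exp (NCSeries.letter 1)))

/-- The homogeneous part `z_k(X, Y) = ∑_{|w| = k} g_w w` of the Goldberg series, each word being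
evaluated at the elements `X`, `Y` of a `𝕜`-algebra. -/
def goldbergTerm (𝕜 : Type*) {A : Type*} [RCLike 𝕜] [Ring A] [Algebra 𝕜 A] (X Y : A) (k : ℕ) : A :=
  ∑ w : Fin k → Fin 2,
    ((goldbergCoeff (List.ofFn w) : ℚ) : 𝕜) • (List.ofFn fun i => ![X, Y] (w i)).prod

/-- The sum `Z = X + Y + ∑_{k ≥ 2} z_k(X, Y)` of the Goldberg series. -/
noncomputable def goldbergSeries (𝕜 : Type*) {A : Type*} [RCLike 𝕜] [NormedRing A]
    [NormedAlgebra 𝕜 A] (X Y : A) : A :=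
  X + Y + ∑' k : ℕ, goldbergTerm 𝕜 X Y (k + 2)

/-!
Put `1 + U = exp (X T) exp (Y T)` with a central variable `T`. Then `z_k` is the coefficient of
`T ^ k` in `log (1 + U) = ∫₀¹ U / (1 + t U) dt`, so it suffices to bound the coefficients of
`U / (1 + t U)` for every `t ∈ [0, 1]`. This series is rational in the block series
`β_t = (exp z - 1) / (1 + t (exp z - 1))` of `z = X T` and `z = Y T`. If `c` is the series of the
absolute values of the coefficients of `β_t` and `q = t (1 - t)`, the coefficients in question are
majorized by those of `(2 c + c²) / (1 - q c²)` at `μ T`. The differential equation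
`β_t' = 1 + (1 - 2 t) β_t - q β_t²` shows that `y = 2 + (2 c + c²) / (1 - q c²)` satisfies
`y' ≪ y² / 2`. As the series `1 / (1 - T)` solves `y' = y²`, with twice the right-hand side, this
leaves enough room to show by induction that the coefficients of `y` are at most `1` from degree `4`
on, once those of low degree have been estimated by hand.

Degrees `2` and `3` follow from the values `1` and `2 / 3` of `∑ |g_w|`; the latter makes the bound
for `Z` strict. The identity `exp X exp Y = exp Z` is the formal identity
`exp (log (1 + U)) = 1 + U` evaluated at `T = 1`.
-/

section

open Finset PowerSeries

section Substitution

theorem coeff_pow_eq_zero_of_lt {R : Type*} [Semiring R] {U : R⟦X⟧} (hU : constantCoeff U = 0)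
    {k n : ℕ} (h : k < n) : coeff k (U ^ n) = 0 :=
  coeff_of_lt_order k <|
    (Nat.cast_lt.mpr h).trans_le (le_order_pow_of_constantCoeff_eq_zero n hU)

theorem coeff_subst_eq_sum {K : Type*} [CommRing K] {g : K⟦X⟧} (hg : constantCoeff g = 0)
    (f : K⟦X⟧) {k N : ℕ} (h : k < N) :
    coeff k (f.subst g) = ∑ n ∈ range N, coeff n f * coeff k (g ^ n) := by
  rw [coeff_subst' (HasSubst.of_constantCoeff_zero' hg), finsum_eq_sum_of_support_subset]
  · rfl
  · intro n hn
    by_contra hnN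
    have hNn : N ≤ n := by simpa using hnN
    exact hn (by simp [coeff_pow_eq_zero_of_lt hg (h.trans_le hNn)])

variable {K A : Type*} [CommRing K] [Ring A] [Algebra K A]

/-- The linear map `f ↦ ∑ₙ fₙ Uⁿ`. The sum is truncated at the degree of the coefficient being
computed, which changes nothing when `U` has no constant term; for other `U` the value is junk. -/
noncomputable def ncSubstLinear (K : Type*) [CommRing K] [Algebra K A] (U : A⟦X⟧) :
    K⟦X⟧ →ₗ[K] A⟦X⟧ where
  toFun f := mk fun k => ∑ n ∈ range (k + 1), coeff n f • coeff k (U ^ n)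
  map_add' f g := by ext; simp [add_smul, sum_add_distrib]
  map_smul' a f := by ext; simp [smul_sum, smul_smul]

theorem coeff_ncSubstLinear {U : A⟦X⟧} (hU : constantCoeff U = 0) (f : K⟦X⟧) {k N : ℕ}
    (h : k < N) :
    coeff k (ncSubstLinear K U f) = ∑ n ∈ range N, coeff n f • coeff k (U ^ n) := by
  simp only [ncSubstLinear, LinearMap.coe_mk, AddHom.coe_mk, coeff_mk]
  refine sum_subset (range_subset_range.mpr h) fun n _ hn => ?_
  rw [coeff_pow_eq_zero_of_lt hU (by simpa using hn), smul_zero]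

theorem coeff_aeval_eq_coeff_ncSubstLinear {U : A⟦X⟧} (hU : constantCoeff U = 0)
    {p : Polynomial K} {f : K⟦X⟧} {k : ℕ} (h : ∀ n ≤ k, p.coeff n = coeff n f) :
    coeff k (Polynomial.aeval U p) = coeff k (ncSubstLinear K U f) := by
  rw [Polynomial.aeval_eq_sum_range, map_sum,
    coeff_ncSubstLinear hU f (show k < max (k + 1) (p.natDegree + 1) by omega)]
  refine (sum_subset (range_subset_range.mpr (le_max_right _ _)) fun n _ hn => ?_).trans
    (sum_congr rfl fun n _ => ?_)
  · rw [Polynomial.coeff_eq_zero_of_natDegree_lt (by simpa using hn), zero_smul, map_zero]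
  · change p.coeff n • coeff k (U ^ n) = _
    rcases le_or_gt n k with hn | hn
    · rw [h n hn]
    · rw [coeff_pow_eq_zero_of_lt hU hn, smul_zero, smul_zero]

theorem ncSubstLinear_one (U : A⟦X⟧) : ncSubstLinear K U 1 = 1 := by
  ext k
  simp [ncSubstLinear, PowerSeries.coeff_one (R := K), ite_smul]

theorem ncSubstLinear_mul {U : A⟦X⟧} (hU : constantCoeff U = 0) (f g : K⟦X⟧) :
    ncSubstLinear K U (f * g) = ncSubstLinear K U f * ncSubstLinear K U g := by
  ext k
  have trunc_coeff (f : K⟦X⟧) (n : ℕ) (hn : n ≤ k) : (trunc (k + 1) f).coeff n = coeff n f := by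
    rw [coeff_trunc, if_pos (by omega)]
  have trunc_mul_coeff (n : ℕ) (hn : n ≤ k) :
      (trunc (k + 1) f * trunc (k + 1) g).coeff n = coeff n (f * g) := by
    rw [coeff_mul_eq_coeff_trunc_mul_trunc f g (Nat.lt_succ_of_le hn), ← Polynomial.coe_mul,
      Polynomial.coeff_coe]
  rw [← coeff_aeval_eq_coeff_ncSubstLinear hU trunc_mul_coeff, map_mul, coeff_mul, coeff_mul]
  refine sum_congr rfl fun p hp => ?_
  have hle : p.1 ≤ k ∧ p.2 ≤ k := by simp at hp; omega
  rw [coeff_aeval_eq_coeff_ncSubstLinear hU fun n hn => trunc_coeff f n (hn.trans hle.1),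
    coeff_aeval_eq_coeff_ncSubstLinear hU fun n hn => trunc_coeff g n (hn.trans hle.2)]

/-- Substitution of a power series `U` without constant term over a possibly noncommutative algebra
into power series over the commutative ring of scalars. `PowerSeries.subst` only covers
commutative targets. -/
noncomputable def ncSubst (K : Type*) [CommRing K] [Algebra K A] (U : A⟦X⟧)
    (hU : constantCoeff U = 0) : K⟦X⟧ →ₐ[K] A⟦X⟧ :=
  AlgHom.ofLinearMap (ncSubstLinear K U) (ncSubstLinear_one U) (ncSubstLinear_mul hU)

theorem coeff_ncSubst {U : A⟦X⟧} (hU : constantCoeff U = 0) (f : K⟦X⟧) {k N : ℕ} (h : k < N) :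
    coeff k (ncSubst K U hU f) = ∑ n ∈ range N, coeff n f • coeff k (U ^ n) :=
  coeff_ncSubstLinear hU f h

theorem ncSubst_X {U : A⟦X⟧} (hU : constantCoeff U = 0) : ncSubst K U hU X = U := by
  ext k
  simp [coeff_ncSubst hU X (show k < k + 2 by omega), coeff_X, ite_smul]

theorem constantCoeff_ncSubst {U : A⟦X⟧} (hU : constantCoeff U = 0) {f : K⟦X⟧}
    (hf : constantCoeff f = 0) : constantCoeff (ncSubst K U hU f) = 0 := by
  rw [← coeff_zero_eq_constantCoeff_apply, coeff_ncSubst hU f zero_lt_one]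
  simp [hf]

theorem ncSubst_subst {U : A⟦X⟧} (hU : constantCoeff U = 0) (f : K⟦X⟧) {g : K⟦X⟧}
    (hg : constantCoeff g = 0) :
    ncSubst K U hU (f.subst g) =
      ncSubst K (ncSubst K U hU g) (constantCoeff_ncSubst hU hg) f := by
  ext k
  rw [coeff_ncSubst _ _ k.lt_succ_self, coeff_ncSubst _ _ k.lt_succ_self]
  simp only [← map_pow, coeff_ncSubst hU _ k.lt_succ_self, smul_sum, smul_smul]
  rw [sum_comm]
  refine sum_congr rfl fun m hm => ?_
  rw [coeff_subst_eq_sum hg f (mem_range.mp hm), sum_smul]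

theorem isUnit_one_add_smul {K A : Type*} [Field K] [Ring A] [Algebra K A] {U : A⟦X⟧}
    (hU : constantCoeff U = 0) (a : K) : IsUnit (1 + a • U) := by
  have hunit : IsUnit (1 + a • X : K⟦X⟧) := isUnit_iff_constantCoeff.mpr (by simp)
  simpa [ncSubst_X] using hunit.map (ncSubst K U hU)

/-- The series `f (x T)`, for an element `x` of a possibly noncommutative algebra. -/
noncomputable def ncRescale (K : Type*) [CommRing K] [Algebra K A] (x : A) : K⟦X⟧ →ₐ[K] A⟦X⟧ :=
  ncSubst K (C x * X) (by simp)

theorem coeff_ncRescale (x : A) (f : K⟦X⟧) (k : ℕ) :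
    coeff k (ncRescale K x f) = coeff k f • x ^ k := by
  have hpow (n : ℕ) : coeff k ((C x * X : A⟦X⟧) ^ n) = if k = n then x ^ n else 0 := by
    rw [(commute_X _).mul_pow, ← map_pow, coeff_C_mul, coeff_X_pow, mul_ite, mul_one, mul_zero]
  rw [ncRescale, coeff_ncSubst _ f k.lt_succ_self]
  simp [hpow]

theorem constantCoeff_ncRescale (x : A) {f : K⟦X⟧} (hf : constantCoeff f = 0) :
    constantCoeff (ncRescale K x f) = 0 :=
  constantCoeff_ncSubst _ hf

end Substitution

section ExpLog

variable (K : Type*) [Field K] [CharZero K]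

theorem derivative_log_mul_one_add_X : d⁄dX K (PowerSeries.log K) * (1 + X) = 1 := by
  rw [deriv_log]
  ext n
  rw [mul_add, mul_one, map_add]
  rcases n with _ | n
  · simp
  · simp [coeff_succ_mul_X, coeff_one, pow_succ]

theorem exp_subst_log : (PowerSeries.exp K).subst (PowerSeries.log K) = 1 + X := by
  set E := (PowerSeries.exp K).subst (PowerSeries.log K) with hE
  set D := d⁄dX K (PowerSeries.log K)
  have hD : D * (1 + X) = 1 := derivative_log_mul_one_add_X K
  have hE' : d⁄dX K E = E * D := by
    rw [hE, derivative_subst HasSubst.log, derivative_exp]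
  have hD' : d⁄dX K D = -D * D := by
    have := congrArg (d⁄dX K) hD
    simp only [Derivation.leibniz, map_add, derivative_X, derivative_one, smul_eq_mul] at this
    linear_combination D * this - d⁄dX K D * hD
  have hE0 : constantCoeff E = 1 := by
    rw [← coeff_zero_eq_constantCoeff_apply, hE, coeff_subst_eq_sum constantCoeff_log _ one_pos]
    simp
  have hD0 : constantCoeff D = 1 := by simpa using congrArg constantCoeff hD
  have hED : E * D = 1 := by
    refine derivative.ext ?_ (by simp [hE0, hD0])
    simp only [Derivation.leibniz, derivative_one, smul_eq_mul, hE', hD']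
    ring
  linear_combination (1 + X) * hED - E * hD

theorem ncSubst_ncSubst_log_exp {A : Type*} [Ring A] [Algebra K A] {U : A⟦X⟧}
    (hU : constantCoeff U = 0) :
    ncSubst K (ncSubst K U hU (PowerSeries.log K)) (constantCoeff_ncSubst hU constantCoeff_log)
      (PowerSeries.exp K) = 1 + U := by
  rw [← ncSubst_subst hU _ constantCoeff_log, exp_subst_log, map_add, map_one, ncSubst_X]

end ExpLog

section WordSeries

variable (K : Type*) {A : Type*} [Field K] [Ring A] [Algebra K A]

/-- The sum of the words of length `k` of a series `f`, evaluated at `x`. -/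
noncomputable def wordSum (x : Fin 2 → A) (f : NCSeries) (k : ℕ) : A :=
  ∑ w : Fin k → Fin 2, ((f (List.ofFn w) : ℚ) : K) • (List.ofFn fun i => x (w i)).prod

theorem wordSum_zero (x : Fin 2 → A) (f : NCSeries) :
    wordSum K x f 0 = ((f [] : ℚ) : K) • (1 : A) := by
  simp [wordSum]

theorem wordSum_succ (x : Fin 2 → A) (f : NCSeries) (k : ℕ) :
    wordSum K x f (k + 1) = ∑ a, x a * wordSum K x (fun w => f (a :: w)) k := by
  rw [wordSum, ← (Fin.consEquiv fun _ => Fin 2).sum_comp, Fintype.sum_prod_type]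
  simp [wordSum, Fin.consEquiv, List.ofFn_succ, mul_sum]

/-- The image of `f` under the evaluation of the letter `a` at `x a • T`: the power series in the
central variable `T` counting the length of words. -/
noncomputable def wordSeries (x : Fin 2 → A) (f : NCSeries) : A⟦X⟧ :=
  mk (wordSum K x f)

theorem coeff_wordSeries (x : Fin 2 → A) (f : NCSeries) (k : ℕ) :
    coeff k (wordSeries K x f) = wordSum K x f k := coeff_mk _ _

theorem wordSeries_one (x : Fin 2 → A) : wordSeries K x NCSeries.one = 1 := by
  ext k
  rw [coeff_wordSeries, coeff_one]
  rcases k with _ | k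
  · simp [wordSum_zero, NCSeries.one]
  · simp [wordSum, NCSeries.one]

theorem wordSeries_letter (x : Fin 2 → A) (a : Fin 2) :
    wordSeries K x (NCSeries.letter a) = C (x a) * X := by
  ext k
  rw [coeff_wordSeries]
  rcases k with _ | k
  · simp [wordSum_zero, NCSeries.letter]
  · rw [wordSum_succ, coeff_succ_mul_X, coeff_C]
    rcases k with _ | k
    · fin_cases a <;> simp [wordSum_zero, NCSeries.letter]
    · simp [wordSum, NCSeries.letter]

variable [CharZero K]

theorem wordSum_add (x : Fin 2 → A) (f g : NCSeries) (k : ℕ) :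
    wordSum K x (f + g) k = wordSum K x f k + wordSum K x g k := by
  simp [wordSum, add_smul, sum_add_distrib]

theorem wordSum_smul (x : Fin 2 → A) (c : ℚ) (f : NCSeries) (k : ℕ) :
    wordSum K x (c • f) k = (c : K) • wordSum K x f k := by
  simp [wordSum, smul_sum, smul_smul]

theorem wordSum_sum_length (x : Fin 2 → A) (c : ℕ → ℚ) (F : ℕ → NCSeries) (s : ℕ → Finset ℕ)
    (k : ℕ) :
    wordSum K x (fun w => ∑ n ∈ s w.length, c n * F n w) k =
      ∑ n ∈ s k, (c n : K) • wordSum K x (F n) k := by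
  simp only [wordSum, List.length_ofFn, smul_sum]
  rw [sum_comm]
  simp [sum_smul, smul_smul]

theorem mul_cons_eq_add_mul (f g : NCSeries) (a : Fin 2) :
    (fun w => NCSeries.mul f g (a :: w)) =
      f [] • (fun w => g (a :: w)) + NCSeries.mul (fun w => f (a :: w)) g := by
  ext w
  simp only [NCSeries.mul, List.length_cons]
  rw [sum_range_succ' _ (w.length + 1), add_comm]
  simp [NCSeries.mul]

theorem wordSum_mul (x : Fin 2 → A) (f g : NCSeries) (k : ℕ) :
    wordSum K x (NCSeries.mul f g) k =
      ∑ p ∈ antidiagonal k, wordSum K x f p.1 * wordSum K x g p.2 := by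
  induction k generalizing f with
  | zero => simp [wordSum_zero, NCSeries.mul, smul_smul, mul_comm]
  | succ k ih =>
    rw [Nat.antidiagonal_succ, sum_cons, sum_map, wordSum_succ]
    simp_rw [mul_cons_eq_add_mul, wordSum_add, wordSum_smul, ih]
    simp only [mul_add, sum_add_distrib, mul_smul_comm, ← smul_sum, ← wordSum_succ]
    congr 1
    · simp [wordSum_zero]
    · simp only [Function.Embedding.prodMap, Function.Embedding.coeFn_mk, Prod.map,
        Function.Embedding.refl_apply, wordSum_succ, sum_mul, mul_sum]
      rw [sum_comm]
      simp [mul_assoc]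

theorem wordSeries_mul (x : Fin 2 → A) (f g : NCSeries) :
    wordSeries K x (NCSeries.mul f g) = wordSeries K x f * wordSeries K x g := by
  ext k
  simp [coeff_mul, coeff_wordSeries, wordSum_mul]

theorem wordSeries_sub (x : Fin 2 → A) (f g : NCSeries) :
    wordSeries K x (f - g) = wordSeries K x f - wordSeries K x g := by
  ext k
  simp [coeff_wordSeries, wordSum, sub_smul]

theorem wordSeries_pow (x : Fin 2 → A) (f : NCSeries) (n : ℕ) :
    wordSeries K x (NCSeries.pow f n) = wordSeries K x f ^ n := by
  induction n with
  | zero => exact wordSeries_one K x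
  | succ n ih => rw [NCSeries.pow, wordSeries_mul, ih, pow_succ']

theorem wordSeries_exp {x : Fin 2 → A} {f : NCSeries}
    (hf : constantCoeff (wordSeries K x f) = 0) :
    wordSeries K x (NCSeries.exp f) = ncSubst K (wordSeries K x f) hf (PowerSeries.exp K) := by
  ext k
  rw [coeff_wordSeries, coeff_ncSubst hf _ k.lt_succ_self]
  refine (wordSum_sum_length K x _ _ (fun l => range (l + 1)) k).trans ?_
  simp only [← coeff_wordSeries, wordSeries_pow]
  simp [coeff_exp]

theorem wordSeries_exp_letter (x : Fin 2 → A) (a : Fin 2) :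
    wordSeries K x (NCSeries.exp (NCSeries.letter a)) = ncRescale K (x a) (PowerSeries.exp K) := by
  have h : constantCoeff (wordSeries K x (NCSeries.letter a)) = 0 := by simp [wordSeries_letter]
  rw [wordSeries_exp K h]
  simp only [wordSeries_letter, ncRescale]

theorem wordSeries_log {x : Fin 2 → A} {f : NCSeries}
    (hf : constantCoeff (wordSeries K x f - 1) = 0) :
    wordSeries K x (NCSeries.log f) =
      ncSubst K (wordSeries K x f - 1) hf (PowerSeries.log K) := by
  ext k
  rw [coeff_wordSeries, coeff_ncSubst hf _ k.lt_succ_self]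
  refine (wordSum_sum_length K x _ _ (fun l => Icc 1 l) k).trans ?_
  rw [sum_range_eq_add_Ico _ (by omega), coeff_log, if_pos rfl, zero_smul, zero_add]
  refine sum_congr (by ext; simp) fun n hn => ?_
  obtain ⟨m, rfl⟩ : ∃ m, n = m + 1 := ⟨n - 1, by simp at hn; omega⟩
  rw [← coeff_wordSeries, wordSeries_pow, wordSeries_sub, wordSeries_one]
  simp [coeff_log, pow_succ]

/-- The series `exp (x T) exp (y T) - 1` in the central variable `T`. -/
noncomputable def expProdSubOne (x y : A) : A⟦X⟧ :=
  ncRescale K x (PowerSeries.exp K) * ncRescale K y (PowerSeries.exp K) - 1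

theorem constantCoeff_expProdSubOne (x y : A) : constantCoeff (expProdSubOne K x y) = 0 := by
  rw [expProdSubOne, map_sub, map_mul, map_one]
  simp only [← coeff_zero_eq_constantCoeff_apply, coeff_ncRescale]
  simp

theorem goldbergTerm_eq_coeff {𝕜 : Type*} [RCLike 𝕜] [Algebra 𝕜 A] (x y : A) (k : ℕ) :
    goldbergTerm 𝕜 x y k =
      coeff k (ncSubst 𝕜 (expProdSubOne 𝕜 x y) (constantCoeff_expProdSubOne 𝕜 x y)
        (PowerSeries.log 𝕜)) := by
  have h : wordSeries 𝕜 ![x, y] (NCSeries.mul (NCSeries.exp (NCSeries.letter 0))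
      (NCSeries.exp (NCSeries.letter 1))) - 1 = expProdSubOne 𝕜 x y := by
    rw [wordSeries_mul, wordSeries_exp_letter, wordSeries_exp_letter]
    rfl
  simp only [← h]
  rw [← wordSeries_log, coeff_wordSeries]
  rfl

end WordSeries

/-- All coefficients of the real power series `f` are nonnegative. The majorant inequality `f ≪ g`
of real power series is expressed as `NonnegCoeff (g - f)`. -/
def NonnegCoeff (f : ℝ⟦X⟧) : Prop := ∀ k, 0 ≤ coeff k f

namespace NonnegCoeff

theorem one : NonnegCoeff 1 := fun k => by
  rw [coeff_one]; split_ifs <;> norm_num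

variable {f g : ℝ⟦X⟧}

theorem add (hf : NonnegCoeff f) (hg : NonnegCoeff g) : NonnegCoeff (f + g) := fun k => by
  rw [map_add]; exact add_nonneg (hf k) (hg k)

theorem mul (hf : NonnegCoeff f) (hg : NonnegCoeff g) : NonnegCoeff (f * g) := fun k => by
  rw [coeff_mul]; exact sum_nonneg fun p _ => mul_nonneg (hf p.1) (hg p.2)

theorem sq (hf : NonnegCoeff f) : NonnegCoeff (f ^ 2) := by
  rw [_root_.sq]; exact hf.mul hf

theorem C_mul {a : ℝ} (ha : 0 ≤ a) (hf : NonnegCoeff f) : NonnegCoeff (C a * f) := fun k => by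
  rw [coeff_C_mul]; exact mul_nonneg ha (hf k)

end NonnegCoeff

theorem coeff_mul_eq_sum_of_constantCoeff_eq_zero {A : Type*} [Semiring A] {f g : A⟦X⟧}
    (hf : constantCoeff f = 0) (k : ℕ) :
    coeff k (f * g) = ∑ p ∈ antidiagonal k with p.2 < k, coeff p.1 f * coeff p.2 g := by
  rw [coeff_mul]
  refine (sum_filter_of_ne fun p hp hne => ?_).symm
  rw [HasAntidiagonal.mem_antidiagonal] at hp
  have hp1 : p.1 ≠ 0 := fun h => hne (by simp [h, hf])
  omega

theorem NonnegCoeff.inv_one_sub {f : ℝ⟦X⟧} (hf : NonnegCoeff f) (h0 : constantCoeff f = 0) :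
    NonnegCoeff (1 - f)⁻¹ := by
  have hI : (1 - f)⁻¹ = 1 + f * (1 - f)⁻¹ := by
    linear_combination PowerSeries.mul_inv_cancel (1 - f) (by simp [h0])
  intro k
  induction k using Nat.strong_induction_on with
  | _ k ih =>
    rw [hI, map_add, coeff_mul_eq_sum_of_constantCoeff_eq_zero h0]
    exact add_nonneg (NonnegCoeff.one k)
      (sum_nonneg fun p hp => mul_nonneg (hf _) (ih _ (mem_filter.mp hp).2))

section Riccati

/-- The amount by which the coefficients of a solution of `y' ≪ y² / 2` may exceed `1` in
`coeff_le_one_of_riccati`. -/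
noncomputable def riccatiExcess : ℕ → ℝ
  | 0 | 1 | 2 => 1
  | 3 => 1 / 3
  | _ => 0

theorem sum_antidiagonal_one_add_riccatiExcess {k : ℕ} (hk : 7 ≤ k) :
    ∑ p ∈ antidiagonal k, (1 + riccatiExcess p.1) * (1 + riccatiExcess p.2) = k + 1 + 20 / 3 := by
  have eq_zero (i : ℕ) (hi : 4 ≤ i) : riccatiExcess i = 0 := by
    obtain ⟨m, rfl⟩ := Nat.exists_eq_add_of_le' hi; rfl
  have sum_excess : ∑ i ∈ range (k + 1), riccatiExcess i = 10 / 3 := by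
    rw [← sum_subset (range_subset_range.mpr (show 4 ≤ k + 1 by omega)) fun i _ hi =>
      eq_zero i (by simpa using hi)]
    norm_num [sum_range_succ, riccatiExcess]
  have sum_fst : ∑ p ∈ antidiagonal k, riccatiExcess p.1 = 10 / 3 := by
    rw [Nat.sum_antidiagonal_eq_sum_range_succ_mk, sum_excess]
  have sum_snd : ∑ p ∈ antidiagonal k, riccatiExcess p.2 = 10 / 3 := by
    rw [← sum_fst, ← Nat.sum_antidiagonal_swap]
    rfl
  calc ∑ p ∈ antidiagonal k, (1 + riccatiExcess p.1) * (1 + riccatiExcess p.2)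
      = ∑ p ∈ antidiagonal k, (1 + riccatiExcess p.1 + riccatiExcess p.2) := by
        refine sum_congr rfl fun p hp => ?_
        rw [HasAntidiagonal.mem_antidiagonal] at hp
        rcases le_or_gt 4 p.1 with h | h
        · rw [eq_zero _ h]; ring
        · rw [eq_zero p.2 (by omega)]; ring
    _ = k + 1 + 20 / 3 := by
        rw [sum_add_distrib, sum_add_distrib, sum_fst, sum_snd]
        simp only [sum_const, Nat.card_antidiagonal, nsmul_eq_mul]
        push_cast
        ring

theorem succ_mul_coeff_succ_le_of_riccati {y : ℝ⟦X⟧}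
    (hy' : NonnegCoeff (C (1 / 2) * y ^ 2 - d⁄dX ℝ y)) (k : ℕ) :
    (k + 1) * coeff (k + 1) y ≤ 1 / 2 * ∑ p ∈ antidiagonal k, coeff p.1 y * coeff p.2 y := by
  have h := hy' k
  rw [map_sub, coeff_C_mul, sq, coeff_mul, coeff_derivative] at h
  linarith

theorem coeff_le_one_add_riccatiExcess {y : ℝ⟦X⟧} (hy : NonnegCoeff y)
    (hy' : NonnegCoeff (C (1 / 2) * y ^ 2 - d⁄dX ℝ y)) (y0 : coeff 0 y ≤ 2)
    (y3 : coeff 3 y ≤ 4 / 3) (y4 : coeff 4 y ≤ 1) (y5 : coeff 5 y ≤ 2 / 3) {k : ℕ} (hk : k ≤ 7) :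
    coeff k y ≤ 1 + riccatiExcess k := by
  have hrec := succ_mul_coeff_succ_le_of_riccati hy'
  have mul_le {i j : ℕ} {a b : ℝ} (ha : coeff i y ≤ a) (hb : coeff j y ≤ b) :
      coeff i y * coeff j y ≤ a * b := mul_le_mul ha hb (hy j) ((hy i).trans ha)
  have y1 : coeff 1 y ≤ 2 := by
    have h := hrec 0
    norm_num [-coeff_zero_eq_constantCoeff] at h
    linarith [mul_le y0 y0]
  have y2 : coeff 2 y ≤ 2 := by
    have h := hrec 1
    norm_num [Nat.antidiagonal_succ, -coeff_zero_eq_constantCoeff] at h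
    linarith [mul_le y0 y1]
  have y6 : coeff 6 y ≤ 1 := by
    have h := hrec 5
    norm_num [Nat.antidiagonal_succ, -coeff_zero_eq_constantCoeff] at h
    linarith [mul_le y0 y5, mul_le y1 y4, mul_le y2 y3]
  have y7 : coeff 7 y ≤ 1 := by
    have h := hrec 6
    norm_num [Nat.antidiagonal_succ, -coeff_zero_eq_constantCoeff] at h
    linarith [mul_le y0 y6, mul_le y1 y5, mul_le y2 y4, mul_le y3 y3]
  interval_cases k <;> norm_num [riccatiExcess, -coeff_zero_eq_constantCoeff] <;> linarith

theorem coeff_le_one_of_riccati {y : ℝ⟦X⟧} (hy : NonnegCoeff y)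
    (hy' : NonnegCoeff (C (1 / 2) * y ^ 2 - d⁄dX ℝ y)) (y0 : coeff 0 y ≤ 2)
    (y3 : coeff 3 y ≤ 4 / 3) (y4 : coeff 4 y ≤ 1) (y5 : coeff 5 y ≤ 2 / 3) {k : ℕ} (hk : 4 ≤ k) :
    coeff k y ≤ 1 := by
  have bound (k : ℕ) : coeff k y ≤ 1 + riccatiExcess k := by
    induction k using Nat.strong_induction_on with
    | _ k ih =>
      rcases le_or_gt k 7 with hk7 | hk7
      · exact coeff_le_one_add_riccatiExcess hy hy' y0 y3 y4 y5 hk7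
      obtain ⟨m, rfl⟩ : ∃ m, k = m + 1 := ⟨k - 1, by omega⟩
      have hm : (7 : ℝ) ≤ m := by exact_mod_cast Nat.le_of_lt_succ hk7
      have hexcess : riccatiExcess (m + 1) = 0 := by
        obtain ⟨j, rfl⟩ := Nat.exists_eq_add_of_le' (show 3 ≤ m by omega); rfl
      rw [hexcess, add_zero]
      refine le_of_mul_le_mul_left ?_ (show (0 : ℝ) < m + 1 by positivity)
      calc (m + 1) * coeff (m + 1) y
          ≤ 1 / 2 * ∑ p ∈ antidiagonal m, coeff p.1 y * coeff p.2 y :=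
            succ_mul_coeff_succ_le_of_riccati hy' m
        _ ≤ 1 / 2 * ∑ p ∈ antidiagonal m, (1 + riccatiExcess p.1) * (1 + riccatiExcess p.2) := by
            gcongr with p hp
            · exact hy p.2
            · exact (hy p.1).trans (ih _ (by simp at hp; omega))
            · exact ih _ (by simp at hp; omega)
            · exact ih _ (by simp at hp; omega)
        _ ≤ (m + 1) * 1 := by
            rw [sum_antidiagonal_one_add_riccatiExcess (by omega)]; linarith
  obtain ⟨j, rfl⟩ := Nat.exists_eq_add_of_le' hk
  exact (bound _).trans_eq (add_zero 1)

end Riccati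

section RiccatiPair

/-- A pair of majorant series satisfying the differential inequalities
`s' ≪ 2 (1 + 2 q e)² + u s (1 + 2 q e)` and `e' ≪ s (1 + 2 q e) + u s² / 2`, where `4 q = 1 - u²`
and `0 ≤ u ≤ 1`. The pair `2 c / (1 - q c²)`, `c² / (1 - q c²)` satisfies them whenever
`c' ≪ 1 + u c + q c²`. -/
structure IsRiccatiPair (u q : ℝ) (s e : ℝ⟦X⟧) : Prop where
  u_nonneg : 0 ≤ u
  u_le_one : u ≤ 1
  four_mul_q : 4 * q = 1 - u ^ 2
  constantCoeff_left : constantCoeff s = 0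
  constantCoeff_right : constantCoeff e = 0
  nonneg_left : NonnegCoeff s
  nonneg_right : NonnegCoeff e
  derivative_left :
    NonnegCoeff (2 * (1 + 2 * C q * e) ^ 2 + C u * s * (1 + 2 * C q * e) - d⁄dX ℝ s)
  derivative_right : NonnegCoeff (s * (1 + 2 * C q * e) + C (u / 2) * s ^ 2 - d⁄dX ℝ e)

namespace IsRiccatiPair

variable {u q : ℝ} {s e : ℝ⟦X⟧} (h : IsRiccatiPair u q s e)
include h

theorem q_eq : q = (1 - u ^ 2) / 4 := by linarith [h.four_mul_q]

theorem u_sq_le_one : u ^ 2 ≤ 1 := pow_le_one₀ h.u_nonneg h.u_le_one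

theorem q_nonneg : 0 ≤ q := by linarith [h.four_mul_q, h.u_sq_le_one]

theorem add_derivative_le :
    NonnegCoeff (C (1 / 2) * (2 + s + e) ^ 2 - d⁄dX ℝ (2 + s + e)) := by
  have hu := h.u_nonneg
  have hu1 := h.u_le_one
  have hq := h.q_eq
  have hu2 := h.u_sq_le_one
  have coeff_e : 0 ≤ 2 - 8 * q := by nlinarith
  have coeff_ee : 0 ≤ 1 / 2 - 8 * q ^ 2 := by nlinarith
  have coeff_se : 0 ≤ 1 - 2 * q - 2 * u * q := by subst hq; nlinarith [sq_nonneg (u - 1 / 3)]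
  have hsum := (((((h.derivative_left.add h.derivative_right).add
    (h.nonneg_right.C_mul coeff_e)).add (h.nonneg_right.sq.C_mul coeff_ee)).add
    (h.nonneg_left.C_mul (sub_nonneg.mpr hu1))).add
    ((h.nonneg_left.mul h.nonneg_right).C_mul coeff_se)).add
    (h.nonneg_left.sq.C_mul (show 0 ≤ (1 - u) / 2 by linarith))
  convert hsum using 1
  have h2 : C (2 : ℝ) = (2 : ℝ⟦X⟧) := map_ofNat C 2
  have h8 : C (8 : ℝ) = (8 : ℝ⟦X⟧) := map_ofNat C 8
  have hhalf : C (1 / 2 : ℝ) * 2 = (1 : ℝ⟦X⟧) := by rw [← h2, ← map_mul]; norm_num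
  have hdiv (a : ℝ) : (C (a / 2) : ℝ⟦X⟧) = C a * C (1 / 2) := by rw [← map_mul]; ring_nf
  have hd2 : d⁄dX ℝ (2 : ℝ⟦X⟧) = 0 := by rw [← h2, derivative_C]
  rw [hdiv u, hdiv (1 - u)]
  simp only [map_add, map_sub, map_mul, map_pow, map_one, h2, h8, hd2]
  linear_combination (2 + 2 * s + 2 * e + s * e) * hhalf

theorem succ_mul_coeff_succ_left_le (k : ℕ) :
    (k + 1) * coeff (k + 1) s ≤ 2 * coeff k 1 + 8 * q * coeff k e +
      8 * q ^ 2 * ∑ x ∈ antidiagonal k, coeff x.1 e * coeff x.2 e + u * coeff k s +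
      2 * u * q * ∑ x ∈ antidiagonal k, coeff x.1 s * coeff x.2 e := by
  have h2 : C (2 : ℝ) = (2 : ℝ⟦X⟧) := map_ofNat C 2
  have h8 : C (8 : ℝ) = (8 : ℝ⟦X⟧) := map_ofNat C 8
  have hexpand : 2 * (1 + 2 * C q * e) ^ 2 + C u * s * (1 + 2 * C q * e) =
      C 2 * 1 + C (8 * q) * e + C (8 * q ^ 2) * (e * e) + C u * s +
        C (2 * u * q) * (s * e) := by
    simp only [map_mul, map_pow, h2, h8]
    ring
  have hk := h.derivative_left k
  simp only [hexpand, map_sub, map_add, coeff_C_mul, coeff_derivative] at hk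
  rw [coeff_mul, coeff_mul] at hk
  linarith

theorem succ_mul_coeff_succ_right_le (k : ℕ) :
    (k + 1) * coeff (k + 1) e ≤ coeff k s +
      2 * q * ∑ x ∈ antidiagonal k, coeff x.1 s * coeff x.2 e +
      u / 2 * ∑ x ∈ antidiagonal k, coeff x.1 s * coeff x.2 s := by
  have h2 : C (2 : ℝ) = (2 : ℝ⟦X⟧) := map_ofNat C 2
  have hexpand : s * (1 + 2 * C q * e) + C (u / 2) * s ^ 2 =
      s + C (2 * q) * (s * e) + C (u / 2) * (s * s) := by
    simp only [map_mul, h2]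
    ring
  have hk := h.derivative_right k
  simp only [hexpand, map_sub, map_add, coeff_C_mul, coeff_derivative] at hk
  rw [coeff_mul, coeff_mul] at hk
  linarith

theorem coeff_one_left_le : coeff 1 s ≤ 2 := by
  simpa [h.constantCoeff_left, h.constantCoeff_right] using h.succ_mul_coeff_succ_left_le 0

theorem coeff_one_right : coeff 1 e = 0 :=
  le_antisymm
    (by simpa [h.constantCoeff_left, h.constantCoeff_right] using h.succ_mul_coeff_succ_right_le 0)
    (h.nonneg_right 1)

theorem coeff_two_left_le : coeff 2 s ≤ u := by
  have hrec : 2 * coeff 2 s ≤ u * coeff 1 s := by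
    simpa [Nat.antidiagonal_succ, h.constantCoeff_left, h.constantCoeff_right, h.coeff_one_right,
      one_add_one_eq_two] using h.succ_mul_coeff_succ_left_le 1
  linarith [mul_le_mul_of_nonneg_left h.coeff_one_left_le h.u_nonneg]

theorem coeff_two_right_le : coeff 2 e ≤ 1 := by
  have hrec : 2 * coeff 2 e ≤ coeff 1 s := by
    simpa [Nat.antidiagonal_succ, h.constantCoeff_left, h.constantCoeff_right, h.coeff_one_right,
      one_add_one_eq_two] using h.succ_mul_coeff_succ_right_le 1
  linarith [h.coeff_one_left_le]

theorem coeff_three_left_le : coeff 3 s ≤ (2 - u ^ 2) / 3 := by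
  have := h.u_nonneg
  have := h.q_nonneg
  have := h.coeff_two_left_le
  have := h.coeff_two_right_le
  have hbound : (2 + 1) * coeff 3 s ≤ (2 + 1) * ((2 - u ^ 2) / 3) :=
    calc (2 + 1) * coeff 3 s ≤ 8 * q * coeff 2 e + u * coeff 2 s := by
          simpa [Nat.antidiagonal_succ, h.constantCoeff_left, h.constantCoeff_right,
            h.coeff_one_right] using h.succ_mul_coeff_succ_left_le 2
      _ ≤ 8 * q * 1 + u * u := by gcongr
      _ = (2 + 1) * ((2 - u ^ 2) / 3) := by rw [h.q_eq]; ring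
  linarith

theorem coeff_three_right_le : coeff 3 e ≤ u := by
  have := h.u_nonneg
  have := h.nonneg_left 1
  have := h.coeff_one_left_le
  have := h.coeff_two_left_le
  have hbound : (2 + 1) * coeff 3 e ≤ (2 + 1) * u :=
    calc (2 + 1) * coeff 3 e ≤ coeff 2 s + u / 2 * (coeff 1 s * coeff 1 s) := by
          simpa [Nat.antidiagonal_succ, h.constantCoeff_left, h.constantCoeff_right,
            h.coeff_one_right] using h.succ_mul_coeff_succ_right_le 2
      _ ≤ u + u / 2 * (2 * 2) := by gcongr
      _ = (2 + 1) * u := by ring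
  linarith

theorem coeff_four_left_le : coeff 4 s ≤ u * (11 - 10 * u ^ 2) / 12 := by
  have := h.u_nonneg
  have := h.q_nonneg
  have := h.nonneg_right 2
  have := h.coeff_one_left_le
  have := h.coeff_two_right_le
  have := h.coeff_three_left_le
  have := h.coeff_three_right_le
  have hbound : (3 + 1) * coeff 4 s ≤ (3 + 1) * (u * (11 - 10 * u ^ 2) / 12) :=
    calc (3 + 1) * coeff 4 s ≤ 8 * q * coeff 3 e + u * coeff 3 s +
            2 * u * q * (coeff 1 s * coeff 2 e) := by
          simpa [Nat.antidiagonal_succ, h.constantCoeff_left, h.constantCoeff_right,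
            h.coeff_one_right] using h.succ_mul_coeff_succ_left_le 3
      _ ≤ 8 * q * u + u * ((2 - u ^ 2) / 3) + 2 * u * q * (2 * 1) := by gcongr
      _ = (3 + 1) * (u * (11 - 10 * u ^ 2) / 12) := by rw [h.q_eq]; ring
  linarith

theorem coeff_four_right_le : coeff 4 e ≤ (5 + 2 * u ^ 2) / 12 := by
  have := h.u_nonneg
  have := h.q_nonneg
  have := h.nonneg_left 1
  have := h.nonneg_left 2
  have := h.nonneg_right 2
  have := h.coeff_one_left_le
  have := h.coeff_two_left_le
  have := h.coeff_two_right_le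
  have := h.coeff_three_left_le
  have hbound : (3 + 1) * coeff 4 e ≤ (3 + 1) * ((5 + 2 * u ^ 2) / 12) :=
    calc (3 + 1) * coeff 4 e ≤ coeff 3 s + 2 * q * (coeff 1 s * coeff 2 e) +
            u / 2 * (coeff 1 s * coeff 2 s + coeff 2 s * coeff 1 s) := by
          simpa [Nat.antidiagonal_succ, h.constantCoeff_left, h.constantCoeff_right,
            h.coeff_one_right] using h.succ_mul_coeff_succ_right_le 3
      _ ≤ (2 - u ^ 2) / 3 + 2 * q * (2 * 1) + u / 2 * (2 * u + u * 2) := by gcongr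
      _ = (3 + 1) * ((5 + 2 * u ^ 2) / 12) := by rw [h.q_eq]; ring
  linarith

theorem coeff_five_left_le : coeff 5 s ≤ 4 / 15 + 11 / 60 * u ^ 2 - 13 / 30 * u ^ 4 := by
  have := h.u_nonneg
  have := h.q_nonneg
  have := h.nonneg_right 2
  have := h.nonneg_right 3
  have := h.coeff_one_left_le
  have := h.coeff_two_left_le
  have := h.coeff_two_right_le
  have := h.coeff_three_right_le
  have := h.coeff_four_left_le
  have := h.coeff_four_right_le
  have hbound : (4 + 1) * coeff 5 s ≤ (4 + 1) * (4 / 15 + 11 / 60 * u ^ 2 - 13 / 30 * u ^ 4) :=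
    calc (4 + 1) * coeff 5 s ≤ 8 * q * coeff 4 e + 8 * q ^ 2 * (coeff 2 e * coeff 2 e) +
            u * coeff 4 s + 2 * u * q * (coeff 1 s * coeff 3 e + coeff 2 s * coeff 2 e) := by
          simpa [Nat.antidiagonal_succ, h.constantCoeff_left, h.constantCoeff_right,
            h.coeff_one_right] using h.succ_mul_coeff_succ_left_le 4
      _ ≤ 8 * q * ((5 + 2 * u ^ 2) / 12) + 8 * q ^ 2 * (1 * 1) +
            u * (u * (11 - 10 * u ^ 2) / 12) + 2 * u * q * (2 * u + u * 1) := by gcongr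
      _ = (4 + 1) * (4 / 15 + 11 / 60 * u ^ 2 - 13 / 30 * u ^ 4) := by rw [h.q_eq]; ring
  linarith

theorem coeff_five_right_le : coeff 5 e ≤ 3 / 4 * u - 1 / 2 * u ^ 3 := by
  have := h.u_nonneg
  have := h.q_nonneg
  have := h.nonneg_left 1
  have := h.nonneg_left 2
  have := h.nonneg_left 3
  have := h.nonneg_right 2
  have := h.nonneg_right 3
  have := h.coeff_one_left_le
  have := h.coeff_two_left_le
  have := h.coeff_two_right_le
  have : 0 ≤ (2 - u ^ 2) / 3 := by linarith [h.u_sq_le_one]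
  have := h.coeff_three_left_le
  have := h.coeff_three_right_le
  have := h.coeff_four_left_le
  have hbound : (4 + 1) * coeff 5 e ≤ (4 + 1) * (3 / 4 * u - 1 / 2 * u ^ 3) :=
    calc (4 + 1) * coeff 5 e ≤ coeff 4 s +
            2 * q * (coeff 1 s * coeff 3 e + coeff 2 s * coeff 2 e) +
            u / 2 * (coeff 1 s * coeff 3 s +
              (coeff 2 s * coeff 2 s + coeff 3 s * coeff 1 s)) := by
          simpa [Nat.antidiagonal_succ, h.constantCoeff_left, h.constantCoeff_right,
            h.coeff_one_right] using h.succ_mul_coeff_succ_right_le 4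
      _ ≤ u * (11 - 10 * u ^ 2) / 12 + 2 * q * (2 * u + u * 1) +
            u / 2 * (2 * ((2 - u ^ 2) / 3) + (u * u + (2 - u ^ 2) / 3 * 2)) := by gcongr
      _ = (4 + 1) * (3 / 4 * u - 1 / 2 * u ^ 3) := by rw [h.q_eq]; ring
  linarith

theorem coeff_add_le_one {k : ℕ} (hk : 4 ≤ k) : coeff k s + coeff k e ≤ 1 := by
  have hu := h.u_nonneg
  have hcube : 0 ≤ u * (u - 2 / 3) ^ 2 := by positivity
  have coeff_sum {n : ℕ} (hn : n ≠ 0) : coeff n (2 + s + e) = coeff n s + coeff n e := by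
    rw [map_add, map_add, ← map_ofNat (C (R := ℝ)) 2, coeff_C_of_ne_zero hn, zero_add]
  have nonneg_two : NonnegCoeff 2 := by
    rw [← one_add_one_eq_two]; exact NonnegCoeff.one.add NonnegCoeff.one
  rw [← coeff_sum (by omega)]
  refine coeff_le_one_of_riccati ((nonneg_two.add h.nonneg_left).add h.nonneg_right)
    h.add_derivative_le ?_ ?_ ?_ ?_ hk
  · simp [h.constantCoeff_left, h.constantCoeff_right, map_ofNat constantCoeff]
  · rw [coeff_sum (by decide)]
    nlinarith [h.coeff_three_left_le, h.coeff_three_right_le,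
      mul_nonneg (sub_nonneg.mpr h.u_le_one) (show 0 ≤ 2 - u by linarith [h.u_le_one])]
  · rw [coeff_sum (by decide)]
    nlinarith [h.coeff_four_left_le, h.coeff_four_right_le, sq_nonneg (u - 2 / 3)]
  · rw [coeff_sum (by decide)]
    nlinarith [h.coeff_five_left_le, h.coeff_five_right_le, sq_nonneg (u - 2 / 3),
      sq_nonneg (u ^ 2 - 4 / 9)]

end IsRiccatiPair

end RiccatiPair

section BlockSeries

/-- The power series `(exp X - 1) / (1 + t (exp X - 1))`. -/
noncomputable def blockSeries (t : ℝ) : ℝ⟦X⟧ :=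
  (PowerSeries.exp ℝ - 1) * (1 + t • (PowerSeries.exp ℝ - 1))⁻¹

theorem one_add_smul_mul_blockSeries (t : ℝ) :
    (1 + t • (PowerSeries.exp ℝ - 1)) * blockSeries t = PowerSeries.exp ℝ - 1 := by
  rw [blockSeries, mul_left_comm, PowerSeries.mul_inv_cancel _ (by simp), mul_one]

theorem constantCoeff_blockSeries (t : ℝ) : constantCoeff (blockSeries t) = 0 := by
  simp [blockSeries]

theorem derivative_blockSeries (t : ℝ) :
    d⁄dX ℝ (blockSeries t) =
      1 + C (1 - 2 * t) * blockSeries t - C (t * (1 - t)) * blockSeries t ^ 2 := by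
  set V : ℝ⟦X⟧ := 1 + t • (PowerSeries.exp ℝ - 1) with hV
  have hVV : V * V⁻¹ = 1 := PowerSeries.mul_inv_cancel _ (by simp [hV])
  have hdV : d⁄dX ℝ V = C t * PowerSeries.exp ℝ := by
    simp [hV, derivative_exp, PowerSeries.smul_eq_C_mul]
  have h2 : C (2 : ℝ) = (2 : ℝ⟦X⟧) := map_ofNat C 2
  rw [blockSeries, ← hV, Derivation.leibniz, derivative_inv', hdV]
  simp only [map_sub, derivative_exp, derivative_one, smul_eq_mul, sub_zero,
    PowerSeries.smul_eq_C_mul, map_mul, map_one, h2] at hV ⊢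
  generalize V⁻¹ = I at hVV ⊢
  rw [hV] at hVV
  linear_combination (1 - C t * (PowerSeries.exp ℝ - 1) * I) * hVV

/-- The series of absolute values of the coefficients of `blockSeries t`. -/
noncomputable def absBlockSeries (t : ℝ) : ℝ⟦X⟧ :=
  PowerSeries.mk fun k => |coeff k (blockSeries t)|

theorem coeff_absBlockSeries (t : ℝ) (k : ℕ) :
    coeff k (absBlockSeries t) = |coeff k (blockSeries t)| :=
  coeff_mk _ _

theorem nonnegCoeff_absBlockSeries (t : ℝ) : NonnegCoeff (absBlockSeries t) := fun k => by
  rw [coeff_absBlockSeries]; exact abs_nonneg _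

theorem constantCoeff_absBlockSeries (t : ℝ) : constantCoeff (absBlockSeries t) = 0 := by
  rw [← coeff_zero_eq_constantCoeff_apply, coeff_absBlockSeries,
    coeff_zero_eq_constantCoeff_apply, constantCoeff_blockSeries, abs_zero]

theorem abs_coeff_blockSeries_sq_le (t : ℝ) (k : ℕ) :
    |coeff k (blockSeries t ^ 2)| ≤ coeff k (absBlockSeries t ^ 2) := by
  rw [sq, sq, coeff_mul, coeff_mul]
  refine (abs_sum_le_sum_abs _ _).trans_eq (sum_congr rfl fun p _ => ?_)
  rw [abs_mul, coeff_absBlockSeries, coeff_absBlockSeries]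

theorem derivative_absBlockSeries_le {t : ℝ} (ht : 0 ≤ t * (1 - t)) :
    NonnegCoeff (1 + C |1 - 2 * t| * absBlockSeries t + C (t * (1 - t)) * absBlockSeries t ^ 2 -
      d⁄dX ℝ (absBlockSeries t)) := fun k => by
  have hderiv : coeff k (d⁄dX ℝ (absBlockSeries t)) = |coeff k (d⁄dX ℝ (blockSeries t))| := by
    rw [coeff_derivative, coeff_derivative, coeff_absBlockSeries, abs_mul,
      abs_of_nonneg (show (0 : ℝ) ≤ k + 1 by positivity)]
  rw [map_sub, sub_nonneg, hderiv, derivative_blockSeries]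
  simp only [map_add, map_sub (coeff k), coeff_C_mul, coeff_absBlockSeries]
  calc |coeff k 1 + (1 - 2 * t) * coeff k (blockSeries t) -
          t * (1 - t) * coeff k (blockSeries t ^ 2)|
      ≤ |coeff k (1 : ℝ⟦X⟧)| + |1 - 2 * t| * |coeff k (blockSeries t)| +
          t * (1 - t) * |coeff k (blockSeries t ^ 2)| := by
        refine (abs_sub _ _).trans (add_le_add ((abs_add_le _ _).trans_eq ?_) ?_)
        · rw [abs_mul]
        · rw [abs_mul, abs_of_nonneg ht]
    _ ≤ coeff k 1 + |1 - 2 * t| * |coeff k (blockSeries t)| +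
          t * (1 - t) * coeff k (absBlockSeries t ^ 2) := by
        rw [abs_of_nonneg (NonnegCoeff.one k)]
        gcongr
        exact abs_coeff_blockSeries_sq_le t k

end BlockSeries

section ResolventMajorant

/-- The series `c / (1 - q c²)`. -/
noncomputable def resolventMajorant (q : ℝ) (c : ℝ⟦X⟧) : ℝ⟦X⟧ := c * (1 - C q * c ^ 2)⁻¹

variable {q : ℝ} {c : ℝ⟦X⟧}

theorem one_sub_mul_sq_mul_inv (c0 : constantCoeff c = 0) :
    (1 - C q * c ^ 2) * (1 - C q * c ^ 2)⁻¹ = 1 :=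
  PowerSeries.mul_inv_cancel _ (by simp [c0])

theorem resolventMajorant_eq (c0 : constantCoeff c = 0) :
    resolventMajorant q c = c + C q * (c * c) * resolventMajorant q c := by
  rw [resolventMajorant]
  linear_combination c * one_sub_mul_sq_mul_inv (q := q) c0

theorem derivative_inv_one_sub_mul_sq (q : ℝ) (c : ℝ⟦X⟧) :
    d⁄dX ℝ (1 - C q * c ^ 2)⁻¹ = 2 * C q * c * d⁄dX ℝ c * (1 - C q * c ^ 2)⁻¹ ^ 2 := by
  rw [derivative_inv', map_sub, derivative_one, Derivation.leibniz, derivative_pow, derivative_C]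
  simp only [smul_eq_mul]
  push_cast
  ring

theorem IsRiccatiPair.resolventMajorant {u : ℝ} (hu0 : 0 ≤ u) (hu1 : u ≤ 1)
    (hq : 4 * q = 1 - u ^ 2) (c0 : constantCoeff c = 0) (hc : NonnegCoeff c)
    (hc' : NonnegCoeff (1 + C u * c + C q * c ^ 2 - d⁄dX ℝ c)) :
    IsRiccatiPair u q (2 * resolventMajorant q c) (c * resolventMajorant q c) := by
  have q0 : 0 ≤ q := by nlinarith
  have hI : NonnegCoeff (1 - C q * c ^ 2)⁻¹ := .inv_one_sub (hc.sq.C_mul q0) (by simp [c0])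
  have hV := one_sub_mul_sq_mul_inv (q := q) c0
  have hdI := derivative_inv_one_sub_mul_sq q c
  have hu : C u = 2 * C (u / 2) := by rw [← map_ofNat (C (R := ℝ)) 2, ← map_mul]; ring_nf
  have nonneg_two : NonnegCoeff 2 := by
    rw [← one_add_one_eq_two]; exact NonnegCoeff.one.add NonnegCoeff.one
  simp only [_root_.resolventMajorant]
  set I := (1 - C q * c ^ 2)⁻¹
  have hW : 1 + 2 * C q * (c * (c * I)) = (1 + C q * c ^ 2) * I := by linear_combination -hV
  refine ⟨hu0, hu1, hq, by simp [c0], by simp [c0], nonneg_two.mul (hc.mul hI),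
    hc.mul (hc.mul hI), ?_, ?_⟩
  · convert nonneg_two.mul ((hc'.mul (NonnegCoeff.one.add (hc.sq.C_mul q0))).mul hI.sq) using 1
    have hd2 : d⁄dX ℝ (2 : ℝ⟦X⟧) = 0 := by rw [← map_ofNat (C (R := ℝ)) 2, derivative_C]
    simp only [Derivation.leibniz, smul_eq_mul, hdI, hW, hd2]
    linear_combination (2 * I * d⁄dX ℝ c) * hV
  · convert nonneg_two.mul ((hc'.mul hc).mul hI.sq) using 1
    simp only [Derivation.leibniz, smul_eq_mul, hdI, hW, hu]
    linear_combination (2 * c * I * d⁄dX ℝ c) * hV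

theorem coeff_resolventMajorant_absBlockSeries_le {t : ℝ} (ht0 : 0 ≤ t) (ht1 : t ≤ 1) {k : ℕ}
    (hk : 4 ≤ k) :
    2 * coeff k (resolventMajorant (t * (1 - t)) (absBlockSeries t)) +
      coeff k (absBlockSeries t * resolventMajorant (t * (1 - t)) (absBlockSeries t)) ≤ 1 := by
  have hpair := IsRiccatiPair.resolventMajorant (abs_nonneg (1 - 2 * t))
    (abs_le.mpr ⟨by linarith, by linarith⟩) (by rw [sq_abs]; ring)
    (constantCoeff_absBlockSeries t) (nonnegCoeff_absBlockSeries t)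
    (derivative_absBlockSeries_le (mul_nonneg ht0 (sub_nonneg.mpr ht1)))
  simpa [← map_ofNat (C (R := ℝ)) 2] using hpair.coeff_add_le_one hk

end ResolventMajorant

section Majorant

variable {A : Type*} [NormedRing A]

/-- The norms of the coefficients of `R` are bounded by the coefficients of `f (μ T)`. -/
def IsMajorant (μ : ℝ) (f : ℝ⟦X⟧) (R : A⟦X⟧) : Prop :=
  ∀ k, ‖coeff k R‖ ≤ coeff k f * μ ^ k

namespace IsMajorant

variable {μ : ℝ} {f g : ℝ⟦X⟧} {R S : A⟦X⟧}

theorem norm_coeff_mul_coeff_le {i j : ℕ} (hR : ‖coeff i R‖ ≤ coeff i f * μ ^ i)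
    (hS : ‖coeff j S‖ ≤ coeff j g * μ ^ j) :
    ‖coeff i R * coeff j S‖ ≤ coeff i f * coeff j g * μ ^ (i + j) :=
  calc ‖coeff i R * coeff j S‖ ≤ ‖coeff i R‖ * ‖coeff j S‖ := norm_mul_le _ _
    _ ≤ (coeff i f * μ ^ i) * (coeff j g * μ ^ j) :=
      mul_le_mul hR hS (norm_nonneg _) ((norm_nonneg _).trans hR)
    _ = coeff i f * coeff j g * μ ^ (i + j) := by ring

theorem mul (hR : IsMajorant μ f R) (hS : IsMajorant μ g S) :
    IsMajorant μ (f * g) (R * S) := fun k => by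
  rw [coeff_mul, coeff_mul, sum_mul]
  refine norm_sum_le_of_le _ fun p hp => ?_
  rw [← HasAntidiagonal.mem_antidiagonal.mp hp]
  exact norm_coeff_mul_coeff_le (hR _) (hS _)

theorem smul [NormedAlgebra ℝ A] (hR : IsMajorant μ f R) (a : ℝ) :
    IsMajorant μ (C |a| * f) (a • R) := fun k => by
  rw [coeff_C_mul, mul_assoc, coeff_smul, norm_smul, Real.norm_eq_abs]
  exact mul_le_mul_of_nonneg_left (hR k) (abs_nonneg a)

theorem of_eq_add_mul {P : A⟦X⟧} {h : ℝ⟦X⟧} (hP0 : constantCoeff P = 0)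
    (hg0 : constantCoeff g = 0) (hS : IsMajorant μ f S) (hP : IsMajorant μ g P)
    (hR : R = S + P * R) (hh : h = f + g * h) : IsMajorant μ h R := fun k => by
  induction k using Nat.strong_induction_on with
  | _ k ih =>
    rw [hR, hh, map_add, map_add, coeff_mul_eq_sum_of_constantCoeff_eq_zero hP0,
      coeff_mul_eq_sum_of_constantCoeff_eq_zero hg0, add_mul, sum_mul]
    refine norm_add_le_of_le (hS k) (norm_sum_le_of_le _ fun p hp => ?_)
    rw [mem_filter, HasAntidiagonal.mem_antidiagonal] at hp
    rw [← hp.1]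
    exact norm_coeff_mul_coeff_le (hP _) (ih _ hp.2)

end IsMajorant

theorem isMajorant_ncRescale_blockSeries [NormedAlgebra ℝ A] {μ : ℝ} {x : A} (hx : ‖x‖ ≤ μ)
    (t : ℝ) : IsMajorant μ (absBlockSeries t) (ncRescale ℝ x (blockSeries t)) := fun k => by
  rw [coeff_ncRescale, coeff_absBlockSeries, norm_smul, Real.norm_eq_abs]
  rcases k.eq_zero_or_pos with rfl | hk
  · simp [constantCoeff_blockSeries]
  · exact mul_le_mul_of_nonneg_left
      ((norm_pow_le' x hk).trans (pow_le_pow_left₀ (norm_nonneg _) hx k)) (abs_nonneg _)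

end Majorant

section Resolvent

-- The formula comes from the factorization `1 + t U = (1 + t ξ) (1 + t (1 - t) a b) (1 + t η)` with
-- `U = (1 + ξ) (1 + η) - 1`.
theorem one_add_smul_mul_resolvent {R : Type*} [Ring R] [Algebra ℝ R] {t : ℝ} {ξ η a b K : R}
    (ha : (1 + t • ξ) * a = ξ) (hb : (1 + t • η) * b = η)
    (hK : (1 + (t * (1 - t)) • (a * b)) * K = 1) :
    (1 + t • (ξ + η + ξ * η)) *
      (b * K + (1 - t) • (a * (b * K)) + (K * a - t • (b * (K * a)))) = ξ + η + ξ * η := by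
  set U := ξ + η + ξ * η with hU
  have left_factor :
      (1 + t • U) * (b + (1 - t) • (a * b)) = (1 + ξ) * η * (1 + (t * (1 - t)) • (a * b)) := by
    linear_combination (norm := skip) (1 - t) • (ha * b) + (1 + ξ) * hb
    simp only [hU, mul_add, add_mul, mul_one, one_mul, mul_smul_comm, smul_mul_assoc, mul_assoc]
    module
  have right_factor : (1 + t • U) * (1 - t • b) = (1 + t • ξ) * (1 + (t * (1 - t)) • (a * b)) := by
    linear_combination (norm := skip) -(t • ((1 + ξ) * hb)) - (t * (1 - t)) • (ha * b)
    simp only [hU, mul_add, add_mul, mul_sub, mul_one, one_mul, mul_smul_comm, smul_mul_assoc,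
      mul_assoc]
    module
  calc (1 + t • U) * (b * K + (1 - t) • (a * (b * K)) + (K * a - t • (b * (K * a))))
      = (1 + t • U) * (b + (1 - t) • (a * b)) * K + (1 + t • U) * (1 - t • b) * K * a := by
        simp only [mul_add, mul_sub, sub_mul, add_mul, mul_one, one_mul, mul_smul_comm,
          smul_mul_assoc, mul_assoc]
    _ = (1 + ξ) * η + (1 + t • ξ) * a := by
        rw [left_factor, right_factor, mul_assoc _ _ K, hK, mul_assoc _ _ K, hK, mul_one, mul_one]
    _ = U := by rw [ha, hU]; noncomm_ring

/-- The power series `X / (1 + t X)`. -/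
noncomputable def geomSeries (t : ℝ) : ℝ⟦X⟧ := X * PowerSeries.mk fun n => (-t) ^ n

theorem one_add_smul_X_mul_geomSeries (t : ℝ) : (1 + t • X) * geomSeries t = X := by
  have hgeom : (1 + t • X) * PowerSeries.mk (fun n => (-t) ^ n) = (1 : ℝ⟦X⟧) := by
    ext n
    rw [add_mul, one_mul, smul_mul_assoc, map_add, coeff_smul]
    rcases n with _ | n
    · simp
    · simp [coeff_succ_X_mul, coeff_one, pow_succ']
  rw [geomSeries, mul_left_comm, hgeom, mul_one]

theorem integral_coeff_geomSeries (n : ℕ) :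
    ∫ t in (0 : ℝ)..1, coeff n (geomSeries t) = coeff n (PowerSeries.log ℝ) := by
  rcases n with _ | n
  · simp [geomSeries]
  · have hpow : (fun t : ℝ => (-t) ^ n) = fun t => (-1) ^ n * t ^ n := funext fun t => neg_pow t n
    simp only [geomSeries, coeff_succ_X_mul, coeff_mk, hpow]
    simp [coeff_log, pow_succ, div_eq_mul_inv]

theorem continuous_coeff_geomSeries (n : ℕ) : Continuous fun t => coeff n (geomSeries t) := by
  rcases n with _ | n
  · simpa [geomSeries] using continuous_const
  · simp only [geomSeries, coeff_succ_X_mul, coeff_mk]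
    fun_prop

theorem one_add_smul_mul_ncSubst_geomSeries {A : Type*} [Ring A] [Algebra ℝ A] {U : A⟦X⟧}
    (hU : constantCoeff U = 0) (t : ℝ) : (1 + t • U) * ncSubst ℝ U hU (geomSeries t) = U := by
  have h := congrArg (ncSubst ℝ U hU) (one_add_smul_X_mul_geomSeries t)
  rwa [map_mul, map_add, map_one, map_smul, ncSubst_X] at h

theorem one_add_smul_mul_ncRescale_blockSeries {A : Type*} [Ring A] [Algebra ℝ A] (x : A) (t : ℝ) :
    (1 + t • (ncRescale ℝ x (PowerSeries.exp ℝ) - 1)) * ncRescale ℝ x (blockSeries t) =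
      ncRescale ℝ x (PowerSeries.exp ℝ) - 1 := by
  have h := congrArg (ncRescale ℝ x) (one_add_smul_mul_blockSeries t)
  rwa [map_mul, map_add, map_one, map_smul, map_sub, map_one] at h

theorem exists_ncSubst_geomSeries_eq {A : Type*} [Ring A] [Algebra ℝ A] (x y : A) (t : ℝ)
    {a b : A⟦X⟧} (ha : a = ncRescale ℝ x (blockSeries t))
    (hb : b = ncRescale ℝ y (blockSeries t)) :
    ∃ L M : A⟦X⟧, L = b + -(t * (1 - t)) • (b * a) * L ∧ M = a + -(t * (1 - t)) • (a * b) * M ∧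
      ncSubst ℝ (expProdSubOne ℝ x y) (constantCoeff_expProdSubOne ℝ x y) (geomSeries t) =
        L + (1 - t) • (a * L) + (M - t • (b * M)) := by
  have ha0 : constantCoeff a = 0 := ha ▸ constantCoeff_ncRescale x (constantCoeff_blockSeries t)
  obtain ⟨K, hK⟩ :=
    (isUnit_one_add_smul (U := a * b) (by simp [ha0]) (t * (1 - t))).exists_right_inv
  have hK' : K = 1 + -(t * (1 - t)) • (a * b) * K := by
    rw [add_mul, one_mul] at hK
    rw [neg_smul, neg_mul, ← sub_eq_add_neg, ← hK, add_sub_cancel_right]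
  refine ⟨b * K, K * a, ?_, ?_, ?_⟩
  · conv_lhs => rw [hK']
    simp only [mul_add, mul_one, smul_mul_assoc, mul_smul_comm, mul_assoc]
  · conv_lhs => rw [hK']
    simp only [add_mul, one_mul, mul_assoc]
  · refine (isUnit_one_add_smul (constantCoeff_expProdSubOne ℝ x y) t).mul_left_cancel ?_
    have hξ := one_add_smul_mul_ncRescale_blockSeries x t
    have hη := one_add_smul_mul_ncRescale_blockSeries y t
    rw [← ha] at hξ
    rw [← hb] at hη
    have hU : expProdSubOne ℝ x y =
        (ncRescale ℝ x (PowerSeries.exp ℝ) - 1) + (ncRescale ℝ y (PowerSeries.exp ℝ) - 1) +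
          (ncRescale ℝ x (PowerSeries.exp ℝ) - 1) * (ncRescale ℝ y (PowerSeries.exp ℝ) - 1) := by
      rw [expProdSubOne]; noncomm_ring
    rw [one_add_smul_mul_ncSubst_geomSeries, hU]
    exact (one_add_smul_mul_resolvent hξ hη hK).symm

variable {A : Type*} [NormedRing A] [NormedAlgebra ℝ A]

theorem isMajorant_resolventMajorant {μ q : ℝ} {c : ℝ⟦X⟧} {a b L : A⟦X⟧} (hq : 0 ≤ q)
    (c0 : constantCoeff c = 0) (a0 : constantCoeff a = 0) (ha : IsMajorant μ c a)
    (hb : IsMajorant μ c b) (hL : L = b + -q • (b * a) * L) :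
    IsMajorant μ (resolventMajorant q c) L := by
  have hP : IsMajorant μ (C q * (c * c)) (-q • (b * a)) := by
    simpa only [abs_neg, abs_of_nonneg hq] using (hb.mul ha).smul (-q)
  exact .of_eq_add_mul (by simp [a0, neg_smul]) (by simp [c0]) hb hP hL (resolventMajorant_eq c0)

theorem norm_coeff_ncSubst_geomSeries_le {x y : A} {μ : ℝ} (hx : ‖x‖ ≤ μ) (hy : ‖y‖ ≤ μ)
    {t : ℝ} (ht0 : 0 ≤ t) (ht1 : t ≤ 1) {k : ℕ} (hk : 4 ≤ k) :
    ‖coeff k (ncSubst ℝ (expProdSubOne ℝ x y) (constantCoeff_expProdSubOne ℝ x y)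
      (geomSeries t))‖ ≤ μ ^ k := by
  obtain ⟨L, M, hL, hM, hG⟩ := exists_ncSubst_geomSeries_eq x y t rfl rfl
  have hq := mul_nonneg ht0 (sub_nonneg.mpr ht1)
  have c0 := constantCoeff_absBlockSeries t
  have a0 (x : A) := constantCoeff_ncRescale x (constantCoeff_blockSeries t)
  have ha := isMajorant_ncRescale_blockSeries hx t
  have hb := isMajorant_ncRescale_blockSeries hy t
  have hL := isMajorant_resolventMajorant hq c0 (a0 x) ha hb hL
  have hM := isMajorant_resolventMajorant hq c0 (a0 y) hb ha hM
  have haL := ha.mul hL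
  have hbM := hb.mul hM
  have hbound := coeff_resolventMajorant_absBlockSeries_le ht0 ht1 hk
  set c := absBlockSeries t
  set R := resolventMajorant (t * (1 - t)) c
  have ht1' : 0 ≤ 1 - t := sub_nonneg.mpr ht1
  rw [hG]
  simp only [map_add, map_sub, coeff_smul]
  calc _ ≤ coeff k R * μ ^ k + (1 - t) * (coeff k (c * R) * μ ^ k) +
        (coeff k R * μ ^ k + t * (coeff k (c * R) * μ ^ k)) := by
        refine norm_add_le_of_le (norm_add_le_of_le (hL k) ?_) (norm_sub_le_of_le (hM k) ?_)
        · rw [norm_smul, Real.norm_of_nonneg ht1']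
          exact mul_le_mul_of_nonneg_left (haL k) ht1'
        · rw [norm_smul, Real.norm_of_nonneg ht0]
          exact mul_le_mul_of_nonneg_left (hbM k) ht0
    _ = (2 * coeff k R + coeff k (c * R)) * μ ^ k := by ring
    _ ≤ μ ^ k := mul_le_of_le_one_left (pow_nonneg ((norm_nonneg x).trans hx) k) hbound

theorem integral_coeff_ncSubst_geomSeries [CompleteSpace A] {U : A⟦X⟧}
    (hU : constantCoeff U = 0) (k : ℕ) :
    ∫ t in (0 : ℝ)..1, coeff k (ncSubst ℝ U hU (geomSeries t)) =
      coeff k (ncSubst ℝ U hU (PowerSeries.log ℝ)) := by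
  simp only [coeff_ncSubst hU _ k.lt_succ_self]
  rw [intervalIntegral.integral_finsetSum]
  · simp only [intervalIntegral.integral_smul_const, integral_coeff_geomSeries]
  · intro n _
    exact ((continuous_coeff_geomSeries n).smul continuous_const).intervalIntegrable _ _

theorem norm_goldbergTerm_real_le_of_four_le [CompleteSpace A] {x y : A} {μ : ℝ}
    (hx : ‖x‖ ≤ μ) (hy : ‖y‖ ≤ μ) {k : ℕ} (hk : 4 ≤ k) : ‖goldbergTerm ℝ x y k‖ ≤ μ ^ k := by
  rw [goldbergTerm_eq_coeff, ← integral_coeff_ncSubst_geomSeries]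
  refine (intervalIntegral.norm_integral_le_of_norm_le_const (C := μ ^ k) fun t ht => ?_).trans
    (by simp)
  rw [Set.uIoc_of_le zero_le_one] at ht
  exact norm_coeff_ncSubst_geomSeries_le hx hy ht.1.le ht.2 hk

end Resolvent

section Evaluation

variable {A : Type*} [NormedRing A] {R S : A⟦X⟧}

theorem summable_norm_coeff_mul (hR : Summable fun k => ‖coeff k R‖)
    (hS : Summable fun k => ‖coeff k S‖) : Summable fun k => ‖coeff k (R * S)‖ := by
  simp only [coeff_mul]
  exact summable_norm_sum_mul_antidiagonal_of_summable_norm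
    (f := fun k => coeff k R) (g := fun k => coeff k S) hR hS

theorem tsum_coeff_mul [CompleteSpace A] (hR : Summable fun k => ‖coeff k R‖)
    (hS : Summable fun k => ‖coeff k S‖) :
    ∑' k, coeff k (R * S) = (∑' k, coeff k R) * ∑' k, coeff k S := by
  simp only [coeff_mul]
  exact (tsum_mul_tsum_eq_tsum_sum_antidiagonal_of_summable_norm hR hS).symm

theorem tsum_norm_coeff_mul_le (hR : Summable fun k => ‖coeff k R‖)
    (hS : Summable fun k => ‖coeff k S‖) :
    ∑' k, ‖coeff k (R * S)‖ ≤ (∑' k, ‖coeff k R‖) * ∑' k, ‖coeff k S‖ := by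
  have hR' : Summable fun k => ‖‖coeff k R‖‖ := by simpa only [norm_norm] using hR
  have hS' : Summable fun k => ‖‖coeff k S‖‖ := by simpa only [norm_norm] using hS
  rw [tsum_mul_tsum_eq_tsum_sum_antidiagonal_of_summable_norm hR' hS']
  refine Summable.tsum_le_tsum (fun k => ?_) (summable_norm_coeff_mul hR hS)
    (summable_norm_sum_mul_antidiagonal_of_summable_norm hR' hS').of_norm
  rw [coeff_mul]
  exact norm_sum_le_of_le _ fun p _ => norm_mul_le _ _

theorem hasSum_coeff_one : HasSum (fun k => coeff k (1 : A⟦X⟧)) 1 := by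
  simp only [coeff_one]
  exact hasSum_ite_eq 0 1

theorem hasSum_norm_coeff_one : HasSum (fun k => ‖coeff k (1 : A⟦X⟧)‖) ‖(1 : A)‖ := by
  simp only [coeff_one, apply_ite norm, norm_zero]
  exact hasSum_ite_eq 0 _

theorem summable_norm_coeff_pow (hR : Summable fun k => ‖coeff k R‖) (n : ℕ) :
    Summable fun k => ‖coeff k (R ^ n)‖ := by
  induction n with
  | zero => rw [pow_zero]; exact hasSum_norm_coeff_one.summable
  | succ n ih => rw [pow_succ]; exact summable_norm_coeff_mul ih hR

theorem tsum_coeff_pow [CompleteSpace A] (hR : Summable fun k => ‖coeff k R‖) (n : ℕ) :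
    ∑' k, coeff k (R ^ n) = (∑' k, coeff k R) ^ n := by
  induction n with
  | zero => rw [pow_zero, pow_zero]; exact hasSum_coeff_one.tsum_eq
  | succ n ih => rw [pow_succ, pow_succ, tsum_coeff_mul (summable_norm_coeff_pow hR n) hR, ih]

theorem tsum_norm_coeff_pow_le (hR : Summable fun k => ‖coeff k R‖) (n : ℕ) :
    ∑' k, ‖coeff k (R ^ n)‖ ≤ ‖(1 : A)‖ * (∑' k, ‖coeff k R‖) ^ n := by
  induction n with
  | zero => rw [pow_zero, pow_zero, mul_one]; exact hasSum_norm_coeff_one.tsum_eq.le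
  | succ n ih =>
    rw [pow_succ, pow_succ, ← mul_assoc]
    exact (tsum_norm_coeff_mul_le (summable_norm_coeff_pow hR n) hR).trans
      (mul_le_mul_of_nonneg_right ih (tsum_nonneg fun _ => norm_nonneg _))

variable {𝕜 : Type*} [NormedField 𝕜] [NormedAlgebra 𝕜 A] [CompleteSpace A]

theorem tsum_coeff_ncSubst (hR0 : constantCoeff R = 0) (hR : Summable fun k => ‖coeff k R‖)
    {f : 𝕜⟦X⟧} (hf : Summable fun n => ‖coeff n f‖ * (∑' k, ‖coeff k R‖) ^ n) :
    ∑' k, coeff k (ncSubst 𝕜 R hR0 f) = ∑' n, coeff n f • (∑' k, coeff k R) ^ n := by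
  have hrow (n : ℕ) : Summable fun k => ‖coeff n f • coeff k (R ^ n)‖ := by
    simp only [norm_smul]
    exact (summable_norm_coeff_pow hR n).mul_left _
  have hrow_le (n : ℕ) : ∑' k, ‖coeff n f • coeff k (R ^ n)‖ ≤
      ‖(1 : A)‖ * (‖coeff n f‖ * (∑' k, ‖coeff k R‖) ^ n) := by
    simp only [norm_smul]
    rw [tsum_mul_left, mul_left_comm]
    exact mul_le_mul_of_nonneg_left (tsum_norm_coeff_pow_le hR n) (norm_nonneg _)
  have hsum : Summable fun p : ℕ × ℕ => coeff p.1 f • coeff p.2 (R ^ p.1) :=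
    .of_norm <| (summable_prod_of_nonneg fun _ => norm_nonneg _).mpr
      ⟨hrow, (hf.mul_left _).of_nonneg_of_le (fun _ => tsum_nonneg fun _ => norm_nonneg _) hrow_le⟩
  calc ∑' k, coeff k (ncSubst 𝕜 R hR0 f) = ∑' k, ∑' n, coeff n f • coeff k (R ^ n) := by
        refine tsum_congr fun k => ?_
        rw [coeff_ncSubst hR0 f k.lt_succ_self]
        refine (tsum_eq_sum fun n hn => ?_).symm
        rw [coeff_pow_eq_zero_of_lt hR0 (by simpa using hn), smul_zero]
    _ = ∑' n, ∑' k, coeff n f • coeff k (R ^ n) := hsum.tsum_comm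
    _ = ∑' n, coeff n f • (∑' k, coeff k R) ^ n := by
        refine tsum_congr fun n => ?_
        rw [(summable_norm_coeff_pow hR n).of_norm.tsum_const_smul, tsum_coeff_pow hR n]

end Evaluation

section Exponential

variable (𝕜 : Type*) {A : Type*} [RCLike 𝕜] [NormedRing A] [NormedAlgebra 𝕜 A]

theorem coeff_exp_eq_inv_factorial (n : ℕ) :
    coeff n (PowerSeries.exp 𝕜) = (n.factorial : 𝕜)⁻¹ := by
  simp [coeff_exp]

theorem summable_norm_coeff_ncRescale_exp (x : A) :
    Summable fun k => ‖coeff k (ncRescale 𝕜 x (PowerSeries.exp 𝕜))‖ := by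
  simp only [coeff_ncRescale, coeff_exp_eq_inv_factorial]
  exact NormedSpace.norm_expSeries_summable' x

theorem tsum_coeff_ncRescale_exp (x : A) :
    ∑' k, coeff k (ncRescale 𝕜 x (PowerSeries.exp 𝕜)) = NormedSpace.exp x := by
  simp only [coeff_ncRescale, coeff_exp_eq_inv_factorial, NormedSpace.exp_eq_tsum 𝕜]

theorem tsum_coeff_ncSubst_exp [CompleteSpace A] {R : A⟦X⟧} (hR0 : constantCoeff R = 0)
    (hR : Summable fun k => ‖coeff k R‖) :
    ∑' k, coeff k (ncSubst 𝕜 R hR0 (PowerSeries.exp 𝕜)) = NormedSpace.exp (∑' k, coeff k R) := by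
  rw [tsum_coeff_ncSubst hR0 hR, NormedSpace.exp_eq_tsum 𝕜]
  · simp only [coeff_exp_eq_inv_factorial]
  · simp only [coeff_exp_eq_inv_factorial, norm_inv, RCLike.norm_natCast, ← div_eq_inv_mul]
    exact Real.summable_pow_div_factorial _

theorem exp_tsum_goldbergTerm [CompleteSpace A] {x y : A}
    (h : Summable fun k => ‖goldbergTerm 𝕜 x y k‖) :
    NormedSpace.exp (∑' k, goldbergTerm 𝕜 x y k) = NormedSpace.exp x * NormedSpace.exp y := by
  simp only [goldbergTerm_eq_coeff] at h ⊢
  rw [← tsum_coeff_ncSubst_exp 𝕜 (constantCoeff_ncSubst _ constantCoeff_log) h,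
    ncSubst_ncSubst_log_exp, expProdSubOne, add_sub_cancel,
    tsum_coeff_mul (summable_norm_coeff_ncRescale_exp 𝕜 x) (summable_norm_coeff_ncRescale_exp 𝕜 y),
    tsum_coeff_ncRescale_exp, tsum_coeff_ncRescale_exp]

end Exponential

section Goldberg

theorem sum_abs_goldbergCoeff_two :
    ∑ w : Fin 2 → Fin 2, |goldbergCoeff (List.ofFn w)| = 1 := by
  decide +kernel

theorem sum_abs_goldbergCoeff_three :
    ∑ w : Fin 3 → Fin 2, |goldbergCoeff (List.ofFn w)| = 2 / 3 := by
  decide +kernel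

theorem goldbergTerm_zero (𝕜 : Type*) {A : Type*} [RCLike 𝕜] [Ring A] [Algebra 𝕜 A] (x y : A) :
    goldbergTerm 𝕜 x y 0 = 0 := by
  rw [goldbergTerm_eq_coeff, coeff_zero_eq_constantCoeff_apply]
  exact constantCoeff_ncSubst _ constantCoeff_log

theorem coeff_one_expProdSubOne (K : Type*) {A : Type*} [Field K] [CharZero K] [Ring A]
    [Algebra K A] (x y : A) : coeff 1 (expProdSubOne K x y) = x + y := by
  simp [expProdSubOne, coeff_mul, Nat.antidiagonal_succ, coeff_ncRescale, coeff_one, add_comm]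

theorem goldbergTerm_one (𝕜 : Type*) {A : Type*} [RCLike 𝕜] [Ring A] [Algebra 𝕜 A] (x y : A) :
    goldbergTerm 𝕜 x y 1 = x + y := by
  rw [goldbergTerm_eq_coeff, coeff_ncSubst _ _ (show 1 < 1 + 1 from one_lt_two)]
  rw [sum_range_succ, sum_range_one]
  simp [coeff_one_expProdSubOne]

theorem goldbergTerm_eq_real (𝕜 : Type*) {A : Type*} [RCLike 𝕜] [Ring A] [Algebra 𝕜 A]
    [Algebra ℝ A] [IsScalarTower ℝ 𝕜 A] (x y : A) (k : ℕ) :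
    goldbergTerm 𝕜 x y k = goldbergTerm ℝ x y k := by
  refine sum_congr rfl fun w _ => ?_
  rw [← algebraMap_smul 𝕜 ((goldbergCoeff (List.ofFn w) : ℚ) : ℝ), map_ratCast]

variable (𝕜 : Type*) {A : Type*} [RCLike 𝕜] [NormedRing A] [NormedAlgebra 𝕜 A] {x y : A} {μ : ℝ}

theorem norm_goldbergTerm_le_sum_abs (hx : ‖x‖ ≤ μ) (hy : ‖y‖ ≤ μ) {k : ℕ} (hk : k ≠ 0) :
    ‖goldbergTerm 𝕜 x y k‖ ≤
      ((∑ w : Fin k → Fin 2, |goldbergCoeff (List.ofFn w)| : ℚ) : ℝ) * μ ^ k := by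
  have norm_letter (i : Fin 2) : ‖![x, y] i‖ ≤ μ := by fin_cases i <;> assumption
  push_cast
  rw [sum_mul]
  refine norm_sum_le_of_le _ fun w _ => ?_
  rw [norm_smul]
  refine mul_le_mul ?_ ?_ (norm_nonneg _) (abs_nonneg _)
  · rw [← map_ratCast (algebraMap ℝ 𝕜), norm_algebraMap', Real.norm_eq_abs]
  · refine (List.norm_prod_le' (by simpa using hk)).trans ?_
    rw [List.map_ofFn, List.prod_ofFn]
    refine (prod_le_prod (fun _ _ => norm_nonneg _) fun i _ => norm_letter (w i)).trans_eq ?_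
    simp

theorem norm_goldbergTerm_three_le (hx : ‖x‖ ≤ μ) (hy : ‖y‖ ≤ μ) :
    ‖goldbergTerm 𝕜 x y 3‖ ≤ 2 / 3 * μ ^ 3 := by
  have h := norm_goldbergTerm_le_sum_abs 𝕜 hx hy three_ne_zero
  rw [sum_abs_goldbergCoeff_three] at h
  push_cast at h
  exact h

theorem goldbergSeries_eq_tsum (h : Summable fun k => goldbergTerm 𝕜 x y (k + 2)) :
    goldbergSeries 𝕜 x y = ∑' k, goldbergTerm 𝕜 x y k := by
  rw [goldbergSeries, ← ((summable_nat_add_iff 2).mp h).sum_add_tsum_nat_add 2]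
  simp [sum_range_succ, goldbergTerm_zero, goldbergTerm_one]

variable [CompleteSpace A]

theorem norm_goldbergTerm_le_of_four_le (hx : ‖x‖ ≤ μ) (hy : ‖y‖ ≤ μ) {k : ℕ} (hk : 4 ≤ k) :
    ‖goldbergTerm 𝕜 x y k‖ ≤ μ ^ k := by
  let _ : NormedAlgebra ℝ A := NormedAlgebra.restrictScalars ℝ 𝕜 A
  have : IsScalarTower ℝ 𝕜 A := RestrictScalars.isScalarTower ℝ 𝕜 A
  rw [goldbergTerm_eq_real]
  exact norm_goldbergTerm_real_le_of_four_le hx hy hk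

theorem norm_goldbergTerm_le (hx : ‖x‖ ≤ μ) (hy : ‖y‖ ≤ μ) {k : ℕ} (hk : 2 ≤ k) :
    ‖goldbergTerm 𝕜 x y k‖ ≤ μ ^ k := by
  obtain rfl | rfl | hk : k = 2 ∨ k = 3 ∨ 4 ≤ k := by omega
  · have h := norm_goldbergTerm_le_sum_abs 𝕜 hx hy two_ne_zero
    rwa [sum_abs_goldbergCoeff_two, Rat.cast_one, one_mul] at h
  · have hμ : 0 ≤ μ ^ 3 := pow_nonneg ((norm_nonneg x).trans hx) 3
    linarith [norm_goldbergTerm_three_le 𝕜 hx hy]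
  · exact norm_goldbergTerm_le_of_four_le 𝕜 hx hy hk

theorem summable_norm_goldbergTerm (hx : ‖x‖ ≤ μ) (hy : ‖y‖ ≤ μ) (hμ : μ < 1) :
    Summable fun k => ‖goldbergTerm 𝕜 x y (k + 2)‖ :=
  ((summable_nat_add_iff 2).mpr
    (summable_geometric_of_lt_one ((norm_nonneg x).trans hx) hμ)).of_nonneg_of_le
      (fun _ => norm_nonneg _) fun _ => norm_goldbergTerm_le 𝕜 hx hy (by omega)

theorem exp_goldbergSeries (h : Summable fun k => ‖goldbergTerm 𝕜 x y (k + 2)‖) :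
    NormedSpace.exp (goldbergSeries 𝕜 x y) = NormedSpace.exp x * NormedSpace.exp y := by
  rw [goldbergSeries_eq_tsum 𝕜 h.of_norm, exp_tsum_goldbergTerm 𝕜]
  exact (summable_nat_add_iff (f := fun k => ‖goldbergTerm 𝕜 x y k‖) 2).mp h

theorem norm_goldbergSeries_lt (hμ₀ : 0 < μ) (hμ₁ : μ < 1) (hx : ‖x‖ ≤ μ) (hy : ‖y‖ ≤ μ) :
    ‖goldbergSeries 𝕜 x y‖ < ‖x‖ + ‖y‖ + ∑' k : ℕ, μ ^ (k + 2) := by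
  have hgeom : Summable fun k : ℕ => μ ^ (k + 2) :=
    (summable_nat_add_iff 2).mpr (summable_geometric_of_lt_one hμ₀.le hμ₁)
  have hsum := summable_norm_goldbergTerm 𝕜 hx hy hμ₁
  have hthree : ‖goldbergTerm 𝕜 x y 3‖ < μ ^ 3 :=
    (norm_goldbergTerm_three_le 𝕜 hx hy).trans_lt (by linarith [pow_pos hμ₀ 3])
  calc ‖goldbergSeries 𝕜 x y‖
      ≤ ‖x‖ + ‖y‖ + ∑' k, ‖goldbergTerm 𝕜 x y (k + 2)‖ :=
        norm_add_le_of_le (norm_add_le _ _) (norm_tsum_le_tsum_norm hsum)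
    _ < ‖x‖ + ‖y‖ + ∑' k : ℕ, μ ^ (k + 2) := by
        gcongr
        exact hsum.tsum_lt_tsum (i := 1)
          (fun k => norm_goldbergTerm_le 𝕜 hx hy (by omega)) hthree hgeom

end Goldberg

end

theorem lemmaA1 {𝕜 A : Type*} [RCLike 𝕜] [NormedRing A] [NormedAlgebra 𝕜 A] [CompleteSpace A]
    (X Y : A) (μ : ℝ) (hμ₀ : 0 < μ) (hμ₁ : μ < 1) (hX : ‖X‖ ≤ μ) (hY : ‖Y‖ ≤ μ) :
    (∀ k : ℕ, 2 ≤ k → ‖goldbergTerm 𝕜 X Y k‖ ≤ μ ^ k) ∧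
    Summable (fun k : ℕ => ‖goldbergTerm 𝕜 X Y (k + 2)‖) ∧
    NormedSpace.exp X * NormedSpace.exp Y = NormedSpace.exp (goldbergSeries 𝕜 X Y) ∧
    ‖goldbergSeries 𝕜 X Y‖ < ‖X‖ + ‖Y‖ + ∑' k : ℕ, μ ^ (k + 2) := by
  have hsum := summable_norm_goldbergTerm 𝕜 hX hY hμ₁
  exact ⟨fun k hk => norm_goldbergTerm_le 𝕜 hX hY hk, hsum, (exp_goldbergSeries 𝕜 hsum).symm,
    norm_goldbergSeries_lt 𝕜 hμ₀ hμ₁ hX hY⟩
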